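/- **Conventions.** A *normal pair* $(N,F)$ is a group $F$ with a normal subgroup $N$. For a group $F$ let $U_F$ be the free group on the symbols $u_x$, $x\in F\setminus\{1\}$ (and put $u_1=1$), and let $J_F$ be the kernel of the evaluation map $U_F\to F$, $u_x\mapsto x$. For a normal pair $(N,F)$ let $U_{N,F}$ be the kernel of the map $U_F\to U_{F/N}$, $u_x\mapsto u_{xN}$, and let $J_{N,F}=U_{N,F}\cap J_F$, which is normal in $U_F$. The *$J$-suspension* of $(N,F)$ is the normal pair $(J_{N,F},U_F)$; its second $J$-suspension is $(J^2_{N,F},U^2_F)$ with $U^2_F=U_{U_F}$ and $J^2_{N,F}=J_{J_{N,F},\,U_F}$. An *$F$-central extension* of $N$ is a group $\overline N$ with an action of $F$ by automorphisms and a surjective homomorphism $p:\overline N\to N$ that is $F$-equivariant (where $F$ acts on $N$ by conjugation), such that $xyx^{-1}=p(x)\cdot y$ for all $x,y\in\overline N$ and $F$ acts trivially on $\ker p$ (hence $\ker p$ is central). Let $[\overline N,F]$ be the subgroup of $\overline N$ generated by all $(f\cdot x)x^{-1}$ with $f\in F$, $x\in\overline N$. The extension is *semiuniversal* if for every $F$-central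 extension $\overline N'$ of $N$ there is an $F$-equivariant homomorphism $\overline N\to\overline N'$ over the identity of $N$, and any two such homomorphisms agree on $[\overline N,F]$. The pair $(N,F)$ is *admissible* if $N$ has a semiuniversal $F$-central extension $\overline N$ whose kernel $\ker(\overline N\to N)$ is contained in $[\overline N,F]$. **Lemma 14 (Suspension Lemma).** Let $(R,U)$ be a normal pair such that $R$ is a free group. Then its $J$-suspension $(J_{R,U},U_U)$ is admissible. In particular, for any normal pair $(N,F)$ the second $J$-suspension $(J^2_{N,F},U^2_F)$ is admissible. -/

import Mathlib

universe u v w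

/-- The free group `U_F` with one free generator `u_x` for every `x ∈ F`, `x ≠ 1`
(so that `u_1 = 1`). -/
abbrev UGroup (F : Type u) [Group F] : Type u := FreeGroup {x : F // x ≠ 1}

namespace UGroup

open Classical in
/-- The element `u_x` of `U_F`; by convention `u_1 = 1`. -/
noncomputable def gen {F : Type u} [Group F] (x : F) : UGroup F :=
  if h : x = 1 then 1 else FreeGroup.of ⟨x, h⟩

/-- The evaluation map `U_F → F`, `u_x ↦ x`. -/
def eval (F : Type u) [Group F] : UGroup F →* F :=
  FreeGroup.lift (fun x : {x : F // x ≠ 1} => (x : F))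

/-- The homomorphism `U_F → U_G`, `u_x ↦ u_{φ x}`, induced by `φ : F → G`. -/
noncomputable def map {F : Type u} {G : Type v} [Group F] [Group G] (φ : F →* G) :
    UGroup F →* UGroup G :=
  FreeGroup.lift (fun x : {x : F // x ≠ 1} => gen (φ x))

end UGroup

/-- `J_F`, the kernel of the evaluation map `U_F → F`. -/
def JFull (F : Type u) [Group F] : Subgroup (UGroup F) := (UGroup.eval F).ker

/-- `U_{N,F}`, the kernel of the induced map `U_F → U_{F/N}`. -/
noncomputable def UPair {F : Type u} [Group F] (N : Subgroup F) [N.Normal] :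
    Subgroup (UGroup F) := (UGroup.map (QuotientGroup.mk' N)).ker

/-- `J_{N,F} = U_{N,F} ∩ J_F`, the kernel of the evaluation map `U_{N,F} → N`.
The `J`-suspension of the normal pair `(N, F)` is the normal pair `(J_{N,F}, U_F)`. -/
noncomputable def JPair {F : Type u} [Group F] (N : Subgroup F) [N.Normal] :
    Subgroup (UGroup F) := UPair N ⊓ JFull F

instance JPair.normal {F : Type u} [Group F] (N : Subgroup F) [N.Normal] :
    (JPair N).Normal := by
  unfold JPair UPair JFull
  infer_instance

/-- An `F`-central extension `1 → C → E → N → 1` of a normal subgroup `N` of `F`: a group `E` on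
which `F` acts by automorphisms, with an equivariant surjection onto `N` (`F` acting on `N` by
conjugation), such that `N ≤ F` acts on `E` through inner automorphisms (the conjugation by an
element of `E` is the action of its image in `N`), and `F` acts trivially on the kernel `C`.
The kernel is then central in `E`, see `FCentralExtension.ker_le_center`. -/
structure FCentralExtension {F : Type u} [Group F] (N : Subgroup F) [N.Normal] where
  /-- The underlying group `E`. -/
  carrier : Type v
  [group : Group carrier]
  [action : MulDistribMulAction F carrier]
  /-- The projection `E → N`. -/
  proj : carrier →* N
  surjective : Function.Surjective proj
  equivariant : ∀ (f : F) (x : carrier), ((proj (f • x) : N) : F) = f * (proj x : F) * f⁻¹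
  conj_eq : ∀ x y : carrier, x * y * x⁻¹ = (proj x : F) • y
  smul_ker : ∀ (f : F) (x : carrier), x ∈ proj.ker → f • x = x

namespace FCentralExtension

attribute [instance] FCentralExtension.group FCentralExtension.action

variable {F : Type u} [Group F] {N : Subgroup F} [N.Normal]

theorem ker_le_center (E : FCentralExtension.{u, v} N) :
    E.proj.ker ≤ Subgroup.center E.carrier := by
  intro x hx
  rw [Subgroup.mem_center_iff]
  intro y
  have h := E.conj_eq x y
  rw [MonoidHom.mem_ker.mp hx, Subgroup.coe_one, one_smul] at h
  exact (mul_inv_eq_iff_eq_mul.mp h).symm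

/-- A morphism of `F`-central extensions of `N`: an `F`-equivariant homomorphism over the
identity of `N`. -/
structure Hom (E : FCentralExtension.{u, v} N) (E' : FCentralExtension.{u, w} N) where
  /-- The underlying homomorphism. -/
  toHom : E.carrier →* E'.carrier
  proj_comp : ∀ x : E.carrier, E'.proj (toHom x) = E.proj x
  map_smul : ∀ (f : F) (x : E.carrier), toHom (f • x) = f • toHom x

/-- The commutator subgroup `[E, F]`, generated by all `(f • x) x⁻¹`. -/
def commutator (E : FCentralExtension.{u, v} N) : Subgroup E.carrier :=
  Subgroup.closure {z | ∃ (f : F) (x : E.carrier), z = (f • x) * x⁻¹}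

/-- `E` is semiuniversal: it maps to every `F`-central extension of `N`, and the map is uniquely
determined on the commutator subgroup `[E, F]`. -/
def IsSemiuniversal (E : FCentralExtension.{u, v} N) : Prop :=
  ∀ E' : FCentralExtension.{u, w} N,
    Nonempty (E.Hom E') ∧
      ∀ φ ψ : E.Hom E', ∀ x ∈ E.commutator, φ.toHom x = ψ.toHom x

end FCentralExtension

/-- The normal pair `(N, F)` is admissible: `N` has a semiuniversal `F`-central extension `E`
whose central kernel is contained in `[E, F]`. The universe `w` is that of the extensions to which
`E` is compared. -/
def IsAdmissible {F : Type u} [Group F] (N : Subgroup F) [N.Normal] : Prop :=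
  ∃ E : FCentralExtension.{u, u} N,
    FCentralExtension.IsSemiuniversal.{u, u, w} E ∧ E.proj.ker ≤ E.commutator

-- Write `F = U_U`, `N = J_{R,U}`, `W = U_{U/R}`. Here `F` is free and `F/N` is a semidirect product
-- of free groups, `R ⋊ W`. This forces every `F`-central extension `E` of `N` to split
-- equivariantly, so `N` is its own semiuniversal extension and the kernel condition is trivial. To
-- split `E`, embed it in a group `(E ⋊ R) ⋊ W` that maps onto `F`, with `E` the preimage of `N` and
-- conjugation on `E` inducing the given action. A section over the free group `F` then restricts to
-- an equivariant map `N → E`. Freeness of `R` and `W` lets `W` act on `E ⋊ R`; this is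
-- `nonempty_hom_of_splittings`.

universe w₂

/-- Homomorphisms out of a free group lift along any homomorphism whose range contains theirs. -/
theorem IsFreeGroup.exists_lift {G H K : Type*} [Group G] [Group H] [Group K] [IsFreeGroup G]
    (f : G →* H) (s : K →* H) (h : ∀ x, ∃ y, s y = f x) : ∃ g : G →* K, ∀ x, s (g x) = f x := by
  choose t ht using h
  refine ⟨IsFreeGroup.lift fun a => t (IsFreeGroup.of a), fun x => ?_⟩
  have : s.comp (IsFreeGroup.lift fun a => t (IsFreeGroup.of a)) = f :=
    IsFreeGroup.ext_hom fun a => by simp [ht]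
  exact DFunLike.congr_fun this x

/-! ### Functoriality of `U_F` -/

namespace UGroup

variable {F : Type u} {G : Type v} [Group F] [Group G]

theorem gen_one : gen (1 : F) = 1 := by simp [gen]

theorem gen_coe (x : {x : F // x ≠ 1}) : gen (x : F) = FreeGroup.of x := by
  simp [gen, x.2]

theorem eval_gen (x : F) : eval F (gen x) = x := by
  by_cases h : x = 1 <;> simp [gen, eval, h]

theorem map_gen (φ : F →* G) (x : F) : map φ (gen x) = gen (φ x) := by
  by_cases h : x = 1 <;> simp [gen, map, h]

theorem eval_map (φ : F →* G) (v : UGroup F) : eval G (map φ v) = φ (eval F v) := by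
  have : (eval G).comp (map φ) = φ.comp (eval F) := by
    ext x
    simp [← gen_coe, map_gen, eval_gen]
  exact DFunLike.congr_fun this v

theorem map_surjective {φ : F →* G} (hφ : Function.Surjective φ) :
    Function.Surjective (map φ) := by
  rw [← MonoidHom.range_eq_top, eq_top_iff, ← FreeGroup.closure_range_of, Subgroup.closure_le]
  rintro _ ⟨x, rfl⟩
  obtain ⟨y, hy⟩ := hφ x
  exact ⟨gen y, by rw [map_gen, hy, gen_coe]⟩

end UGroup

namespace FCentralExtension

variable {F : Type u} [Group F] {N : Subgroup F} [N.Normal]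

/-- Two morphisms of central extensions agree on the commutator subgroup: they differ by a
homomorphism into the kernel of the target, on which `F` acts trivially. -/
theorem Hom.eqOn_commutator {E : FCentralExtension.{u, v} N} {E' : FCentralExtension.{u, w} N}
    (φ ψ : E.Hom E') : ∀ x ∈ E.commutator, φ.toHom x = ψ.toHom x := by
  change E.commutator ≤ φ.toHom.eqLocus ψ.toHom
  rw [commutator, Subgroup.closure_le]
  rintro _ ⟨f, x, rfl⟩
  change φ.toHom (f • x * x⁻¹) = ψ.toHom (f • x * x⁻¹)
  have hc : ψ.toHom x⁻¹ * φ.toHom x ∈ E'.proj.ker := by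
    rw [MonoidHom.mem_ker, map_mul, φ.proj_comp, ψ.proj_comp, ← map_mul, inv_mul_cancel, map_one]
  have hf := E'.smul_ker f _ hc
  rw [smul_mul', ← ψ.map_smul, ← φ.map_smul, smul_inv', map_inv, map_inv, inv_mul_eq_iff_eq_mul,
    ← mul_assoc] at hf
  rw [map_mul, map_mul, map_inv, map_inv, hf]
  group

/-- The normal subgroup `N`, with the conjugation action, as an `F`-central extension of itself. -/
def self (N : Subgroup F) [N.Normal] : FCentralExtension.{u, u} N where
  carrier := N
  action := MulDistribMulAction.compHom (M := MulAut N) N (MulAut.conjNormal : F →* MulAut N)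
  proj := MonoidHom.id N
  surjective := Function.surjective_id
  equivariant f x := MulAut.conjNormal_apply f x
  conj_eq x y := Subtype.ext (MulAut.conjNormal_apply (x : F) y).symm
  smul_ker f x hx := by
    obtain rfl : x = 1 := hx
    exact map_one (MulAut.conjNormal f)

/-! ### Thickenings of a central extension -/

/-- A group over `F` that contains `E` as the preimage of `N`, and whose conjugation action on `E`
is the given action of `F`. -/
structure Thickening (E : FCentralExtension.{u, v} N) where
  /-- The underlying group. -/
  carrier : Type w
  [group : Group carrier]
  /-- The inclusion of `E`. -/
  incl : E.carrier →* carrier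
  /-- The projection to `F`. -/
  proj : carrier →* F
  incl_injective : Function.Injective incl
  proj_incl : ∀ e, proj (incl e) = E.proj e
  exists_incl_eq : ∀ t, proj t ∈ N → ∃ e, incl e = t
  conj_incl : ∀ t e, t * incl e * t⁻¹ = incl (proj t • e)

namespace Thickening

attribute [instance] Thickening.group

variable {E : FCentralExtension.{u, v} N}

/-- The automorphism `α` of a thickening covers the conjugation by `f` and extends the action of
`f` on `E`. -/
structure LiftsConj (T : Thickening E) (f : F) (α : MulAut T.carrier) : Prop where
  proj_apply : ∀ t, T.proj (α t) = f * T.proj t * f⁻¹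
  apply_incl : ∀ e, α (T.incl e) = T.incl (f • e)

/-- An endomorphism of a thickening that covers a conjugation and extends the action on `E` is
bijective. -/
theorem bijective_of_conj (T : Thickening E) (f : F) (α : T.carrier →* T.carrier)
    (hproj : ∀ t, T.proj (α t) = f * T.proj t * f⁻¹)
    (hincl : ∀ e, α (T.incl e) = T.incl (f • e))
    (hf : ∀ t, ∃ s, T.proj s = f⁻¹ * T.proj t * f) : Function.Bijective α := by
  -- An element over `1` comes from `ker E.proj`, where `F` acts trivially.
  have hfix : ∀ t, T.proj t = 1 → α t = t := by
    intro t ht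
    obtain ⟨e, rfl⟩ := T.exists_incl_eq t (ht ▸ N.one_mem)
    rw [hincl, E.smul_ker]
    exact Subtype.ext (by rw [← T.proj_incl, ht, Subgroup.coe_one])
  constructor
  · refine (injective_iff_map_eq_one α).2 fun t ht => ?_
    rw [← hfix t, ht]
    have := hproj t
    rw [ht, map_one] at this
    exact conj_eq_one_iff.1 this.symm
  · intro t
    obtain ⟨s, hs⟩ := hf t
    -- Both `α s` and `t` lie over the same element, so the correction `(α s)⁻¹ * t` is fixed by
    -- `α`.
    refine ⟨s * ((α s)⁻¹ * t), ?_⟩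
    rw [map_mul, hfix ((α s)⁻¹ * t), mul_inv_cancel_left]
    rw [map_mul, map_inv, hproj, hs]
    group

/-- The automorphisms lifting conjugations, as a subgroup of `MulAut T × F`. -/
def conjLifts (T : Thickening E) : Subgroup (MulAut T.carrier × F) where
  carrier := {x | T.LiftsConj x.2 x.1}
  one_mem' := ⟨by simp, by simp⟩
  mul_mem' {x y} hx hy :=
    ⟨fun t => by simp [hx.proj_apply, hy.proj_apply, mul_assoc],
      fun e => by simp [hx.apply_incl, hy.apply_incl, mul_smul]⟩
  inv_mem' {x} hx :=
    ⟨fun t => by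
      have := hx.proj_apply (x.1⁻¹ t)
      rw [MulAut.apply_inv_self] at this
      simp only [Prod.fst_inv, Prod.snd_inv, this]
      group,
    fun e => by
      simp only [Prod.fst_inv, Prod.snd_inv]
      apply x.1.injective
      rw [MulAut.apply_inv_self, hx.apply_incl, smul_inv_smul]⟩

/-- Conjugations along a homomorphism from a free group lift simultaneously if each of them
does. -/
theorem exists_liftsConj_hom (T : Thickening E) {W : Type*} [Group W] [IsFreeGroup W]
    (τ : W →* F) (h : ∀ w, ∃ α, T.LiftsConj (τ w) α) :
    ∃ β : W →* MulAut T.carrier, ∀ w, T.LiftsConj (τ w) (β w) := by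
  obtain ⟨g, hg⟩ := IsFreeGroup.exists_lift τ
    ((MonoidHom.snd (MulAut T.carrier) F).comp T.conjLifts.subtype)
    fun w => (h w).elim fun α hα => ⟨⟨(α, τ w), hα⟩, rfl⟩
  refine ⟨(MonoidHom.fst _ _).comp (T.conjLifts.subtype.comp g), fun w => ?_⟩
  rw [← hg w]
  exact (g w).2

/-- A central extension is a thickening of itself. -/
def refl (E : FCentralExtension.{u, v} N) : Thickening.{u, v, v} E where
  carrier := E.carrier
  incl := MonoidHom.id _
  proj := N.subtype.comp E.proj
  incl_injective := Function.injective_id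
  proj_incl _ := rfl
  exists_incl_eq t _ := ⟨t, rfl⟩
  conj_incl := E.conj_eq

/-- The semidirect product of a thickening with a group acting by lifts of conjugations. -/
def semidirect (T : Thickening.{u, v, w} E) {W : Type w₂} [Group W] (τ : W →* F)
    (β : W →* MulAut T.carrier) (hβ : ∀ w, T.LiftsConj (τ w) (β w))
    (hτ : ∀ t w, T.proj t * τ w ∈ N → w = 1) : Thickening.{u, v, max w w₂} E where
  carrier := T.carrier ⋊[β] W
  incl := SemidirectProduct.inl.comp T.incl
  proj := SemidirectProduct.lift T.proj τ fun w => by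
    ext t
    simp [(hβ w).proj_apply]
  incl_injective := SemidirectProduct.inl_injective.comp T.incl_injective
  proj_incl e := by simp [T.proj_incl]
  exists_incl_eq x hx := by
    obtain ⟨t, w⟩ := x
    obtain rfl : w = 1 := hτ t w hx
    obtain ⟨e, rfl⟩ := T.exists_incl_eq t (by simpa using hx)
    exact ⟨e, by simp⟩
  conj_incl x e := by
    obtain ⟨t, w⟩ := x
    simp only [SemidirectProduct.mk_eq_inl_mul_inr, MonoidHom.comp_apply, map_mul,
      SemidirectProduct.lift_inl, SemidirectProduct.lift_inr, mul_smul, ← T.conj_incl,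
      ← (hβ w).apply_incl, SemidirectProduct.inl_aut, map_inv]
    group

/-- A thickening that covers a free group `F` splits, and the splitting restricts to a morphism
from `N` to `E`. -/
theorem nonempty_hom [IsFreeGroup F] (T : Thickening E) (hT : Function.Surjective T.proj) :
    Nonempty ((self N).Hom E) := by
  -- The section `θ` sends `N` into the preimage of `N`, which is `E`.
  obtain ⟨θ, hθ⟩ := IsFreeGroup.exists_lift (MonoidHom.id F) T.proj hT
  have hθ' : ∀ x, T.proj (θ x) = x := hθ
  choose s hs using fun n : N => T.exists_incl_eq (θ n) ((hθ' n).symm ▸ n.2)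
  have hmul : ∀ a b, s (a * b) = s a * s b := fun a b => T.incl_injective (by
    rw [map_mul, hs, hs, hs, Subgroup.coe_mul, map_mul])
  exact ⟨{
    toHom := (MonoidHom.mk' s hmul : N →* E.carrier)
    proj_comp := fun (n : N) => Subtype.ext (by
      change (E.proj (s n) : F) = n
      rw [← T.proj_incl, hs, hθ'])
    map_smul := fun f (n : N) => T.incl_injective (by
      change T.incl (s (MulAut.conjNormal f n)) = T.incl (f • s n)
      have := T.conj_incl (θ f) (s n)
      rw [hθ'] at this
      rw [← this, hs, hs, MulAut.conjNormal_apply, map_mul, map_mul, map_inv]) }⟩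

end Thickening

/-! ### Splitting when `F/N` is built from free groups -/

/-- Let `F` be free and `F/N` an iterated semidirect product `R ⋊ W` of free groups, given by a
split surjection `q` of `F` onto `W` and a split surjection `ε` of `ker q` onto `R` with
kernel `N`. Then every `F`-central extension of `N` splits. -/
theorem nonempty_hom_of_splittings [IsFreeGroup F] {R W : Type*} [Group R] [Group W]
    [IsFreeGroup R] [IsFreeGroup W] (q : F →* W) (hq : Function.Surjective q)
    (ε : q.ker →* R) (hε : Function.Surjective ε)
    (hN : N ≤ q.ker) (hεN : ∀ k, ε k = 1 ↔ (k : F) ∈ N)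
    (E : FCentralExtension.{u, v} N) : Nonempty ((self N).Hom E) := by
  obtain ⟨τ, hτ⟩ := IsFreeGroup.exists_lift (MonoidHom.id W) q hq
  obtain ⟨σ, hσ⟩ := IsFreeGroup.exists_lift (MonoidHom.id R) ε hε
  have hτ' : ∀ w, q (τ w) = w := hτ
  have hσ' : ∀ r, ε (σ r) = r := hσ
  let φ : R →* MulAut E.carrier :=
    (MulDistribMulAction.toMulAut F E.carrier).comp (q.ker.subtype.comp σ)
  let T : Thickening E := (Thickening.refl E).semidirect (q.ker.subtype.comp σ) φ
    (fun r => ⟨fun e => E.equivariant _ _, fun e => rfl⟩) (fun e r h => by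
      have h' : (σ r : F) ∈ N := (N.mul_mem_cancel_left (E.proj e).2).1 h
      rw [← hσ' r, hεN]
      exact h')
  have hker : ∀ t, T.proj t ∈ q.ker := fun (t : E.carrier ⋊[φ] R) =>
    q.ker.mul_mem (hN (E.proj t.left).2) (σ t.right).2
  have hsurj : ∀ k ∈ q.ker, ∃ t, T.proj t = k := by
    intro k hk
    have hmem : k * (σ (ε ⟨k, hk⟩) : F)⁻¹ ∈ N := by
      refine (hεN (⟨k, hk⟩ * (σ (ε ⟨k, hk⟩))⁻¹)).1 ?_
      rw [map_mul, map_inv, hσ', mul_inv_cancel]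
    obtain ⟨e, he⟩ := E.surjective ⟨_, hmem⟩
    refine ⟨(⟨e, ε ⟨k, hk⟩⟩ : E.carrier ⋊[φ] R), ?_⟩
    change (E.proj e : F) * (σ (ε ⟨k, hk⟩) : F) = k
    rw [he, inv_mul_cancel_right]
  have hlift : ∀ f, ∃ α, T.LiftsConj f α := by
    intro f
    -- `T = E ⋊ R` has image `ker q`, which is normal, so the conjugate by `f` of `σ` lifts to `T`
    -- because `R` is free.
    obtain ⟨l, hl⟩ := IsFreeGroup.exists_lift
      ((MulAut.conj f).toMonoidHom.comp (q.ker.subtype.comp σ)) T.proj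
      fun r => hsurj _ (q.normal_ker.conj_mem _ (σ r).2 f)
    have hl' : ∀ r, T.proj (l r) = f * σ r * f⁻¹ := hl
    -- Any choice of `l` is compatible with `f` on `E`: conjugation by `l r` on `E` depends only on
    -- its image `f * σ r * f⁻¹`.
    let α : T.carrier →* T.carrier := SemidirectProduct.lift (φ := φ)
      (T.incl.comp (MulDistribMulAction.toMonoidHom E.carrier f)) l fun r => by
        ext e
        change T.incl (f • (σ r : F) • e) = l r * T.incl (f • e) * (l r)⁻¹
        rw [T.conj_incl, hl', smul_smul, smul_smul, inv_mul_cancel_right]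
    have hα : ∀ e, α (T.incl e) = T.incl (f • e) := fun e => SemidirectProduct.lift_inl _ _ _ e
    have hproj : ∀ t, T.proj (α t) = f * T.proj t * f⁻¹ := by
      intro (t : E.carrier ⋊[φ] R)
      change T.proj (T.incl (f • t.left) * l t.right) =
        f * ((E.proj t.left : F) * (σ t.right : F)) * f⁻¹
      rw [map_mul, T.proj_incl, E.equivariant, hl']
      group
    exact ⟨MulEquiv.ofBijective α (T.bijective_of_conj f α hproj hα fun t => hsurj _ (by
      simpa using q.normal_ker.conj_mem _ (hker t) f⁻¹)), hproj, hα⟩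
  obtain ⟨β, hβ⟩ := T.exists_liftsConj_hom τ fun w => hlift _
  -- `q` kills both `N` and the image of `T`, so an element over `N` has trivial `W`-component.
  refine (T.semidirect τ β hβ fun t w h => ?_).nonempty_hom fun x => ?_
  · have := MonoidHom.mem_ker.1 (hN h)
    rwa [map_mul, MonoidHom.mem_ker.1 (hker t), one_mul, hτ'] at this
  · obtain ⟨t, ht⟩ := hsurj (x * (τ (q x))⁻¹) (by simp [MonoidHom.mem_ker, hτ'])
    refine ⟨(⟨t, q x⟩ : T.carrier ⋊[β] W), ?_⟩
    change T.proj t * τ (q x) = x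
    rw [ht, inv_mul_cancel_right]

end FCentralExtension

/-- If `N` maps to all of its `F`-central extensions, then `N` itself is semiuniversal, with
trivial kernel. It is then the only witness of admissibility: any other one splits as `N × C`, and
`C ≤ [N × C, F] = [N, F]` forces `C = 1`. -/
theorem isAdmissible_of_nonempty_hom {F : Type u} [Group F] {N : Subgroup F} [N.Normal]
    (h : ∀ E : FCentralExtension.{u, w} N, Nonempty ((FCentralExtension.self N).Hom E)) :
    IsAdmissible.{u, w} N := by
  refine ⟨FCentralExtension.self N, fun E => ⟨h E, FCentralExtension.Hom.eqOn_commutator⟩, ?_⟩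
  intro x hx
  obtain rfl : x = 1 := hx
  exact one_mem _

/-- The `J`-suspension of a normal pair `(R, U)` with `R` free is admissible: the quotient
`U_U / J_{R,U}` is the semidirect product of the free group `U_{U/R}` acting on `R`. -/
theorem isAdmissible_JPair {U : Type u} [Group U] (R : Subgroup U) [R.Normal] [IsFreeGroup R] :
    IsAdmissible.{u, w} (JPair R) := by
  have hmem : ∀ k : (UGroup.map (QuotientGroup.mk' R)).ker, UGroup.eval U k ∈ R := fun k => by
    rw [← QuotientGroup.eq_one_iff, ← QuotientGroup.mk'_apply, ← UGroup.eval_map,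
      MonoidHom.mem_ker.1 k.2, map_one]
  refine isAdmissible_of_nonempty_hom fun E =>
    FCentralExtension.nonempty_hom_of_splittings (N := JPair R)
      (UGroup.map (QuotientGroup.mk' R))
      (UGroup.map_surjective (QuotientGroup.mk'_surjective R))
      (((UGroup.eval U).comp (Subgroup.subtype _)).codRestrict R hmem) (fun r => ?_)
      inf_le_left (fun k => ?_) E
  -- `u_r` dies in `U_{U/R}` thanks to the convention `u_1 = 1`.
  · refine ⟨⟨UGroup.gen r, ?_⟩, Subtype.ext (UGroup.eval_gen _)⟩
    rw [MonoidHom.mem_ker, UGroup.map_gen, QuotientGroup.mk'_apply,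
      (QuotientGroup.eq_one_iff _).2 r.2, UGroup.gen_one]
  · exact ⟨fun h => ⟨k.2, congrArg Subtype.val h⟩, fun h => Subtype.ext h.2⟩

theorem lemma14 :
    (∀ (U : Type u) [Group U] (R : Subgroup U) [R.Normal], IsFreeGroup R →
      IsAdmissible.{u, w} (JPair R)) ∧
    (∀ (F : Type u) [Group F] (N : Subgroup F) [N.Normal],
      IsAdmissible.{u, w} (JPair (JPair N))) :=
  -- `J_{N,F}` is free by Nielsen–Schreier, being a subgroup of the free group `U_F`.
  ⟨fun _ _ R _ _ => isAdmissible_JPair R, fun _ _ N _ => isAdmissible_JPair (JPair N)⟩
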